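/- Let $k\in\mathbb C$, $\tau\in\mathbb H$ (the upper half-plane) and $q=e^{2\pi i\tau}$. Let $a,d$ generate the rank-2 Heisenberg vertex algebra with $\langle a,a\rangle=\langle d,d\rangle=0$, $\langle a,d\rangle=2$, so $[g_m,h_n]=m\langle g,h\rangle\delta_{m+n,0}$, and put $T^\Pi=\tfrac12{:}ad{:}+\tfrac k3\partial a-\tfrac12\partial d$, of central charge $c=8k+2$. For $\ell\in\mathbb Z$ and $[\nu]\in\mathbb R/\mathbb Z$ let $\Pi_\nu^\ell=\bigoplus_{\lambda\in[\nu]}\mathcal F_{\lambda a+(\ell-1)d/2}$ be the direct sum of Fock spaces underlying the irreducible module of the half-lattice vertex algebra $\Pi$ generated by $e^{\nu a+(\ell-1)d/2}$, and let $$\mathrm{ch}[\Pi_\nu^\ell](\zeta_a,\zeta_d;\tau)=\mathrm{tr}_{\Pi_\nu^\ell}\; e^{2\pi i\zeta_a a_0}\,e^{2\pi i\zeta_d d_0}\,q^{T^\Pi_0-c/24},\qquad \zeta_a,\zeta_d\in\mathbb C .$$ For fixed $\zeta_a$ and $\tau$, this is regarded as a distribution in $\zeta_d\in\mathbb C$: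 the sum over the eigenvalues of $d_0$ is a series of exponentials in $\zeta_d$, integrated term by term against smooth compactly supported test functions with respect to arc length on the line where its terms are bounded. For $s\in\mathbb C^\times$, the character $\mathrm{ch}[\Pi_\nu^\ell](\zeta_a,s\zeta_d;\tau)$ is understood in the same way as a distribution in $\zeta_d$. Delta functions of affine functions, with $\alpha\neq0$, are correspondingly normalised by $\delta(\alpha\zeta+\beta)=|\alpha|^{-1}\delta_{-\beta/\alpha}$, where $\delta_p$ denotes evaluation at $p$. Then this series converges and, for all $s\in\mathbb C^\times$, $$\mathrm{ch}[\Pi_\nu^\ell](\zeta_a,s\zeta_d;\tau)=\frac{e^{2\pi i\zeta_a(\ell-1)}e^{-2\pi ik\ell\tau/3}}{\eta(\tau)^2}\sum_{n\in\mathbb Z}e^{2\pi in\nu}\,\delta(2s\zeta_d+\ell\tau-n),$$ where $\eta$ is the Dedekind eta function. Moreover, for all $k\in\mathbb C$, $\ell\in\mathbb Z$, $[\nu]\in\mathbb R/\mathbb Z$, $\zeta_a\in\mathbb C$ and $\tau\in\mathbb H$, one has, as distributions in $\zeta_d$, $$\mathrm{ch}[\Pi_\nu^\ell]\!\left(\tfrac{\zeta_a}{\tau},\tfrac{\zeta_d}{\tau};-\tfrac1\tau\right)=A(\zeta_a,\zeta_d;\tau)\sum_{\ell'\in\mathbb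 Z}\int_{\mathbb R/\mathbb Z}S_{(\ell,\nu),(\ell',\nu')}\,\mathrm{ch}[\Pi_{\nu'}^{\ell'}](\zeta_a,\zeta_d;\tau)\,d[\nu'],$$ $$S_{(\ell,\nu),(\ell',\nu')}=e^{2\pi i(\ell+\ell')k/3}\,e^{-2\pi i(\ell\nu'+\ell'\nu)},$$ $$A(\zeta_a,\zeta_d;\tau)=\frac{|\tau|}{-i\tau}\,e^{4\pi i\zeta_a\zeta_d/\tau}\,e^{2\pi i\zeta_a(\tau-1)/\tau}\,e^{-4\pi ik\zeta_d(\tau-1)/(3\tau)}.$$ Here, after multiplication by the smooth function $A$ and pairing with any test function, the integrals over $\nu'$ and the sum over $\ell'$ converge absolutely. -/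

import Mathlib

open scoped Distributions ContDiff UpperHalfPlane ModularForm

noncomputable section

namespace HalfLattice

/-! ### The Heisenberg algebra and its Fock spaces -/

/-- The two basis vectors `a`, `d` of the abelian Lie algebra `π`. -/
inductive Gen : Type
  | a
  | d
  deriving DecidableEq

instance : Fintype Gen := ⟨{Gen.a, Gen.d}, fun g => by cases g <;> simp⟩

/-- The symmetric bilinear form on `π`: `⟨a,a⟩ = ⟨d,d⟩ = 0` and `⟨a,d⟩ = 2`. -/
def form (g h : Gen) : ℂ := if g = h then 0 else 2

/-- The underlying space of a Fock space of the rank-2 Heisenberg vertex algebra: polynomials in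
the creation operators. The variable `(g, n)` is `g_{-n}`, for `g ∈ {a, d}` and `n ≥ 1`; the
constant `1` is the highest-weight vector. -/
abbrev Fock : Type := MvPolynomial (Gen × ℕ+) ℂ

/-- The mode `g_n`, for `n ∈ ℤ`, acting on the Fock space of highest weight
`μ = μ_a a + μ_d d ∈ π`: the zero mode `g_0` acts as the scalar `⟨g, μ⟩`, the mode `g_{-n}` with
`n ≥ 1` multiplies by the corresponding variable, and `g_n` with `n ≥ 1` acts as
`n ∑_h ⟨g, h⟩ ∂/∂h_{-n}`. Hence `[g_m, h_n] = m ⟨g, h⟩ δ_{m+n,0}`. -/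
def fockMode (μ : Gen → ℂ) (g : Gen) : ℤ → Module.End ℂ Fock
  | Int.ofNat 0 => (∑ h, form g h * μ h) • LinearMap.id
  | Int.ofNat (n + 1) =>
      ((n : ℂ) + 1) • ∑ h, form g h • (MvPolynomial.pderiv (h, n.succPNat)).toLinearMap
  | Int.negSucc n => LinearMap.mulLeft ℂ (MvPolynomial.X (g, n.succPNat))

/-- The operator `a_{-(n+1)} d_{n+1} + d_{-(n+1)} a_{n+1}`. -/
def fockPair (μ : Gen → ℂ) (n : ℕ) : Module.End ℂ Fock :=
  fockMode μ Gen.a (Int.negSucc n) * fockMode μ Gen.d (Int.ofNat (n + 1)) +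
    fockMode μ Gen.d (Int.negSucc n) * fockMode μ Gen.a (Int.ofNat (n + 1))

/-- On each vector, only finitely many of these operators are nonzero. -/
lemma finite_support_fockPair (μ : Gen → ℂ) (v : Fock) :
    (Function.support fun n : ℕ => fockPair μ n v).Finite := by
  refine ((v.vars.image fun x => x.2.natPred).finite_toSet).subset ?_
  intro n hn
  by_contra hmem
  refine hn ?_
  have hz : ∀ h : Gen, MvPolynomial.pderiv (h, n.succPNat) v = 0 := by
    intro h
    refine MvPolynomial.pderiv_eq_zero_of_notMem_vars ?_
    intro hv
    refine hmem ?_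
    simp only [Finset.coe_image, Set.mem_image, Finset.mem_coe]
    exact ⟨_, hv, by simp⟩
  simp [fockPair, fockMode, hz]

/-- The sum of a locally finite family of operators. -/
def locallyFiniteSum {M : Type*} [AddCommGroup M] [Module ℂ M] (f : ℕ → Module.End ℂ M)
    (hf : ∀ v, (Function.support fun n => f n v).Finite) : Module.End ℂ M where
  toFun v := ∑ᶠ n : ℕ, f n v
  map_add' v w := by
    simp only [map_add]
    exact finsum_add_distrib (hf v) (hf w)
  map_smul' c v := by
    simp only [map_smul, RingHom.id_apply]
    exact (smul_finsum' c (hf v)).symm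

/-- The zero mode of the normally ordered product of `a` and `d`:
`(:ad:)_0 = a_0 d_0 + ∑_{n ≥ 1} (a_{-n} d_n + d_{-n} a_n)`, a locally finite sum. -/
def fockNormalOrderedAD (μ : Gen → ℂ) : Module.End ℂ Fock :=
  fockMode μ Gen.a 0 * fockMode μ Gen.d 0 +
    locallyFiniteSum (fockPair μ) (finite_support_fockPair μ)

/-- The zero mode of `T^Π = ½ :ad: + (k/3) ∂a - ½ ∂d`. Since `(∂h)_n = -(n+1) h_n` for a field
`h(z) = ∑ h_n z^{-n-1}`, it is `½ (:ad:)_0 - (k/3) a_0 + ½ d_0`. -/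
def fockT (k : ℂ) (μ : Gen → ℂ) : Module.End ℂ Fock :=
  (1 / 2 : ℂ) • fockNormalOrderedAD μ - (k / 3) • fockMode μ Gen.a 0
    + (1 / 2 : ℂ) • fockMode μ Gen.d 0

/-! ### The half-lattice modules -/

/-- The weight `λ a + (ℓ - 1) d / 2`. -/
def weight (ℓ : ℤ) (lam : ℝ) : Gen → ℂ
  | Gen.a => lam
  | Gen.d => ((ℓ : ℂ) - 1) / 2

/-- The real numbers `λ` in the coset `ν = [λ] ∈ ℝ/ℤ`. -/
abbrev Coset (ν : UnitAddCircle) : Type := {lam : ℝ // (lam : UnitAddCircle) = ν}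

/-- The module `Π_ν^ℓ` in its Fock space realisation: the direct sum over `λ ∈ ν` of the Fock
spaces generated by `e^{λ a + (ℓ-1) d/2}`, with the modes `g_n` and `T^Π_0` acting as below
(through which `ℓ` enters). The modes of the fields `e^{ma}(z)`, which permute the summands,
do not occur in the character. -/
abbrev HalfLatticeModule (ν : UnitAddCircle) : Type := DirectSum (Coset ν) fun _ => Fock

/-- The action of the Heisenberg mode `g_n` on `Π_ν^ℓ`. -/
def moduleMode (ν : UnitAddCircle) (ℓ : ℤ) (g : Gen) (n : ℤ) :
    Module.End ℂ (HalfLatticeModule ν) :=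
  DirectSum.lmap fun lam : Coset ν => fockMode (weight ℓ lam) g n

/-- The action of `T^Π_0` on `Π_ν^ℓ`. -/
def moduleT (k : ℂ) (ν : UnitAddCircle) (ℓ : ℤ) : Module.End ℂ (HalfLatticeModule ν) :=
  DirectSum.lmap fun lam : Coset ν => fockT k (weight ℓ lam)

/-- The central charge `8k + 2`. -/
def centralCharge (k : ℂ) : ℂ := 8 * k + 2

/-! ### Characters as traces -/

section Trace

variable {M : Type*} [AddCommGroup M] [Module ℂ M]

/-- The dimension of the joint eigenspace of `(a₀, d₀, T₀)` with eigenvalues `(α, β, h)`. -/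
def multiplicity (a₀ d₀ T₀ : Module.End ℂ M) (α β h : ℂ) : ℕ :=
  Module.finrank ℂ ↥(a₀.eigenspace α ⊓ d₀.eigenspace β ⊓ T₀.eigenspace h)

/-- The part of `tr z_a^{a₀} z_d^{d₀} q^{T₀ - c/24}` coming from the `β`-eigenspace of `d₀`,
where `z_a = e^{2πi ζa}`, `z_d = e^{2πi ζd}`, `q = e^{2πi τ}`. -/
def traceTerm (a₀ d₀ T₀ : Module.End ℂ M) (c ζa ζd τ β : ℂ) : ℂ :=
  (∑' p : ℂ × ℂ, (multiplicity a₀ d₀ T₀ p.1 β p.2 : ℂ) *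
    Complex.exp (2 * Real.pi * Complex.I * (p.1 * ζa + (p.2 - c / 24) * τ))) *
  Complex.exp (2 * Real.pi * Complex.I * (β * ζd))

/-- The set of `z ∈ ℂ` such that the terms of the trace at `ζd = f z` form a bounded family.
(For the modules `Π_ν^ℓ` and `f z = z`, this is the real line `|z_d² q^ℓ| = 1`; everywhere else
the terms grow exponentially.) -/
def boundedLocus (a₀ d₀ T₀ : Module.End ℂ M) (c ζa τ : ℂ) (f : ℂ → ℂ) : Set ℂ :=
  {z | ∃ B : ℝ, ∀ β : ℂ, ‖traceTerm a₀ d₀ T₀ c ζa (f z) τ β‖ ≤ B}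

/-- The distribution `u` on `ℂ` is the character `z ↦ tr z_a^{a₀} z_d^{d₀} q^{T₀ - c/24}`,
evaluated at `ζd = f z`: the series of exponentials given by the trace, taken with respect to arc
length (one-dimensional Hausdorff measure) on the locus where its terms are bounded, converges to
`u` in the sense of distributions. -/
def IsDistributionalCharacter (a₀ d₀ T₀ : Module.End ℂ M) (c ζa τ : ℂ) (f : ℂ → ℂ)
    (u : 𝓓((⊤ : TopologicalSpace.Opens ℂ), ℂ) →L[ℂ] ℂ) : Prop :=
  ∀ φ : 𝓓((⊤ : TopologicalSpace.Opens ℂ), ℂ),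
    (∀ β : ℂ, MeasureTheory.IntegrableOn
      (fun z => traceTerm a₀ d₀ T₀ c ζa (f z) τ β * φ z)
      (boundedLocus a₀ d₀ T₀ c ζa τ f) (MeasureTheory.Measure.hausdorffMeasure 1)) ∧
    HasSum
      (fun β : ℂ => ∫ z in boundedLocus a₀ d₀ T₀ c ζa τ f,
        traceTerm a₀ d₀ T₀ c ζa (f z) τ β * φ z
          ∂(MeasureTheory.Measure.hausdorffMeasure 1))
      (u φ)

end Trace

/-! ### Dirac deltas and the explicit form of the characters -/

/-- The Dirac delta `δ(α z + β)` of an affine function with `α ≠ 0`, paired with a test function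
`φ` of `z ∈ ℂ`. As usual for a delta in one variable (taken with respect to arc length along the
real line of `z` for which `α z + β` is real), `δ(α z + β) = |α|⁻¹ δ(z + β/α)`. -/
def diracAffine (α β : ℂ) : 𝓓((⊤ : TopologicalSpace.Opens ℂ), ℂ) →L[ℂ] ℂ where
  toFun φ := (‖α‖⁻¹ : ℂ) * φ (-β / α)
  map_add' φ ψ := by simp [mul_add]
  map_smul' c φ := by simp; ring
  cont := continuous_const.mul (continuous_eval_const _)

/-- A compact set contains only finitely many of the points at which `α z + β - n` vanishes. -/
lemma finite_points {α : ℂ} (hα : α ≠ 0) (β : ℂ) {K : Set ℂ} (hK : IsCompact K) :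
    {n : ℤ | -(β - n) / α ∈ K}.Finite := by
  obtain ⟨R, hR⟩ := hK.isBounded.exists_norm_le
  refine (Set.finite_Icc (-⌈‖α‖ * R + ‖β‖⌉) ⌈‖α‖ * R + ‖β‖⌉).subset ?_
  intro n hn
  have h1 := hR _ hn
  have h2 : ((n : ℂ)) = α * (-(β - n) / α) + β := by
    field_simp
    ring
  have h3 : |(n : ℝ)| ≤ ‖α‖ * R + ‖β‖ := by
    calc |(n : ℝ)| = ‖(n : ℂ)‖ := by simp
      _ = ‖α * (-(β - n) / α) + β‖ := by rw [← h2]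
      _ ≤ ‖α‖ * ‖-(β - n) / α‖ + ‖β‖ := by
        rw [← norm_mul]
        exact norm_add_le _ _
      _ ≤ ‖α‖ * R + ‖β‖ := by gcongr
  have h4 := abs_le.1 (h3.trans (Int.le_ceil _))
  constructor
  · exact_mod_cast h4.1
  · exact_mod_cast h4.2

lemma finite_support_dirac {α : ℂ} (hα : α ≠ 0) (β : ℂ) (w : ℤ → ℂ)
    (φ : 𝓓((⊤ : TopologicalSpace.Opens ℂ), ℂ)) :
    (Function.support fun n : ℤ => w n * diracAffine α (β - n) φ).Finite := by
  refine (finite_points hα β φ.hasCompactSupport).subset ?_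
  intro n hn
  refine subset_tsupport _ ?_
  intro h0
  refine hn ?_
  change w n * ((‖α‖⁻¹ : ℂ) * φ (-(β - n) / α)) = 0
  rw [h0, mul_zero, mul_zero]

/-- The distribution `∑_{n ∈ ℤ} w_n δ(α z + β - n)`, for `α ≠ 0`: a sum which is finite on each
test function. -/
def diracComb (w : ℤ → ℂ) (α β : ℂ) (hα : α ≠ 0) :
    𝓓((⊤ : TopologicalSpace.Opens ℂ), ℂ) →L[ℂ] ℂ :=
  TestFunction.mkCLM ℂ
    (fun φ => ∑ᶠ n : ℤ, w n * diracAffine α (β - n) φ)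
    (fun φ ψ => by
      rw [← finsum_add_distrib (finite_support_dirac hα β w φ) (finite_support_dirac hα β w ψ)]
      exact finsum_congr fun n => by rw [map_add, mul_add])
    (fun c φ => by
      rw [smul_finsum]
      exact finsum_congr fun n => by simp only [map_smul, smul_eq_mul]; ring)
    (fun K hK => by
      have hfin := finite_points hα β K.isCompact
      have h : ((fun φ : 𝓓((⊤ : TopologicalSpace.Opens ℂ), ℂ) =>
            ∑ᶠ n : ℤ, w n * diracAffine α (β - n) φ) ∘ TestFunction.ofSupportedIn hK) =
          fun φ => ∑ n ∈ hfin.toFinset,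
            w n * diracAffine α (β - n) (TestFunction.ofSupportedIn hK φ) := by
        funext φ
        refine finsum_eq_sum_of_support_subset _ ?_
        intro n hn
        simp only [Set.Finite.coe_toFinset, Set.mem_ofPred_eq]
        by_contra hmem
        refine hn ?_
        have h0 : φ (-(β - n) / α) = 0 := φ.zero_on_compl hmem
        change w n * ((‖α‖⁻¹ : ℂ) * φ (-(β - n) / α)) = 0
        rw [h0, mul_zero, mul_zero]
      rw [h]
      refine continuous_finsetSum _ fun n _ => continuous_const.mul ?_
      exact (diracAffine α (β - n)).continuous.comp (TestFunction.continuous_ofSupportedIn hK))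

/-- The character `ch[Π_ν^ℓ](ζa, s ζd; τ)`, as a distribution in `ζd ∈ ℂ`:
`e^{2πi ζa (ℓ-1)} e^{-2πi k ℓ τ/3} η(τ)⁻² ∑_{n ∈ ℤ} e^{2πi n ν} δ(2 s ζd + ℓ τ - n)`.
Here `fourier n ν = e^{2πi n ν}`. -/
def character (k : ℂ) (ν : UnitAddCircle) (ℓ : ℤ) (ζa s τ : ℂ) (hs : s ≠ 0) :
    𝓓((⊤ : TopologicalSpace.Opens ℂ), ℂ) →L[ℂ] ℂ :=
  (Complex.exp (2 * Real.pi * Complex.I * (ζa * ((ℓ : ℂ) - 1))) *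
      Complex.exp (-(2 * Real.pi * Complex.I * (k * ℓ * τ / 3))) / (η τ) ^ 2) •
    diracComb (fun n => fourier n ν) (2 * s) (ℓ * τ) (mul_ne_zero two_ne_zero hs)

/-! ### The S-transformation data -/

/-- The S-matrix `e^{2πi (ℓ+ℓ') k/3} e^{-2πi (ℓ ν' + ℓ' ν)}`, with `fourier n x = e^{2πi n x}`. -/
def Smatrix (k : ℂ) (ℓ : ℤ) (ν : UnitAddCircle) (ℓ' : ℤ) (ν' : UnitAddCircle) : ℂ :=
  Complex.exp (2 * Real.pi * Complex.I * (((ℓ : ℂ) + ℓ') * k / 3)) *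
    (fourier (-ℓ) ν' * fourier (-ℓ') ν)

/-- The automorphy factor `A(ζa, ζd; τ)`. -/
def automorphy (k ζa τ ζd : ℂ) : ℂ :=
  (‖τ‖ : ℂ) / (-Complex.I * τ) *
    Complex.exp (4 * Real.pi * Complex.I * (ζa * ζd / τ)) *
    Complex.exp (2 * Real.pi * Complex.I * (ζa * (τ - 1) / τ)) *
    Complex.exp (-(4 * Real.pi * Complex.I * (k * ζd * (τ - 1) / (3 * τ))))

lemma contDiff_automorphy (k ζa τ : ℂ) : ContDiff ℝ ∞ (automorphy k ζa τ) := by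
  unfold automorphy
  fun_prop

/-- The product `g φ` of a smooth function and a test function. The product of `g` and a
distribution `u` is the distribution `φ ↦ u (g φ)`. -/
def mulTest (g : ℂ → ℂ) (hg : ContDiff ℝ ∞ g) (φ : 𝓓((⊤ : TopologicalSpace.Opens ℂ), ℂ)) :
    𝓓((⊤ : TopologicalSpace.Opens ℂ), ℂ) where
  toFun z := g z * φ z
  contDiff' := hg.mul φ.contDiff
  hasCompactSupport' := φ.hasCompactSupport.mul_left
  tsupport_subset' := by simp

end HalfLattice

end

/-!
The operators `a₀`, `d₀` and `T₀` are diagonal in the basis of `Π_ν^ℓ` given by monomials in the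
creation operators. On a monomial of energy `N` in the Fock space of weight `λ a + (ℓ - 1) d / 2`
their eigenvalues are `ℓ - 1`, `2λ` and `ℓλ - (k/3)(ℓ - 1) + N` (`multiplicity_module`). The monomials
are two-coloured partitions, so their generating function is `∏ (1 - q ^ n)⁻²`, which together with
the shift by the central charge gives `1 / η(τ)²` (`hasSum_exp_energy`). Hence the part of the trace
with `d₀ = 2λ` is a nonzero constant times `exp (2πi λ (2 s ζd + ℓ τ))` (`traceTerm_two_mul`).

As `λ` runs over a coset of `ℤ`, these terms are bounded exactly on the line where
`2 s ζd + ℓ τ` is real (`boundedLocus_eq`). In the coordinate `x = 2 s ζd + ℓ τ` on this line, arc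
length is `|2 s|⁻¹ dx`, and the sum over `λ` of the integrals against a test function is the sum of
its Fourier coefficients at the frequencies `λ`. By Poisson summation (`hasSum_integral_exp_mul`)
this is the pairing with `|2 s|⁻¹ ∑ e^{2πi n ν} δ_{x = n}`.

For the modular transformation, orthogonality of the characters of `ℝ/ℤ` reduces the integral over
`ν'` to the single delta function at `ζd = (ℓ - ℓ' τ) / 2`
(`integral_Smatrix_mul_character`). The delta functions of the transformed character sit at
`ζd = (ℓ + n τ) / 2`, so the two sides match for `n = -ℓ'`, and the coefficients agree because of
the values of `A` at these points and of `η(-1/τ)² = -i τ η(τ)²` (`prefactor_transform`).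
-/

noncomputable section

namespace HalfLattice

/-! ### Joint eigenspaces on the half-lattice modules -/

/-- The joint eigenspaces of three operators that are diagonal in a common basis: their dimension
counts the basis vectors with the given eigenvalues (with `0` on both sides if there are
infinitely many). -/
lemma multiplicity_eq_card {ι M : Type*} [AddCommGroup M] [Module ℂ M]
    (b : Module.Basis ι ℂ M) {A D T : Module.End ℂ M} {α β h : ι → ℂ}
    (hA : ∀ i, A (b i) = α i • b i) (hD : ∀ i, D (b i) = β i • b i)
    (hT : ∀ i, T (b i) = h i • b i) (x y z : ℂ) :
    multiplicity A D T x y z = Nat.card {i // α i = x ∧ β i = y ∧ h i = z} := by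
  have key : ∀ (E : Module.End ℂ M) (ε : ι → ℂ), (∀ i, E (b i) = ε i • b i) → ∀ (c : ℂ) (v : M),
      E v = c • v ↔ ∀ i, b.repr v i ≠ 0 → ε i = c := by
    intro E ε hE c v
    have hrepr : ∀ i, b.repr (E v) i = ε i * b.repr v i := by
      intro i
      have : (b.coord i ∘ₗ E) = ε i • b.coord i := by
        refine b.ext fun j => ?_
        rcases eq_or_ne j i with rfl | hij
        · simp [hE]
        · simp [hE, Finsupp.single_eq_of_ne hij.symm]
      exact congrArg (fun f => f v) this
    rw [← b.repr.injective.eq_iff, Finsupp.ext_iff]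
    refine forall_congr' fun i => ?_
    rw [hrepr, map_smul, Finsupp.smul_apply, smul_eq_mul, mul_eq_mul_right_iff, or_comm,
      or_iff_not_imp_left]
  have hspan : A.eigenspace x ⊓ D.eigenspace y ⊓ T.eigenspace z =
      Submodule.span ℂ (Set.range fun i : {i // α i = x ∧ β i = y ∧ h i = z} => b i) := by
    ext v
    have hr : Set.range (fun i : {i // α i = x ∧ β i = y ∧ h i = z} => b i) =
        b '' {i | α i = x ∧ β i = y ∧ h i = z} := by
      ext w
      simp
    rw [hr, Module.Basis.mem_span_image, Submodule.mem_inf, Submodule.mem_inf,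
      Module.End.mem_eigenspace_iff, Module.End.mem_eigenspace_iff, Module.End.mem_eigenspace_iff,
      key A α hA, key D β hD, key T h hT]
    constructor
    · intro H i hi
      have hi' := Finsupp.mem_support_iff.1 hi
      exact ⟨H.1.1 i hi', H.1.2 i hi', H.2 i hi'⟩
    · intro H
      have H' : ∀ i, b.repr v i ≠ 0 → α i = x ∧ β i = y ∧ h i = z :=
        fun i hi => H (Finsupp.mem_support_iff.2 hi)
      exact ⟨⟨fun i hi => (H' i hi).1, fun i hi => (H' i hi).2.1⟩, fun i hi => (H' i hi).2.2⟩
  have hli : LinearIndependent ℂ (fun i : {i // α i = x ∧ β i = y ∧ h i = z} => b i) :=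
    b.linearIndependent.comp _ Subtype.val_injective
  rw [multiplicity, hspan, Module.finrank_eq_nat_card_basis (Module.Basis.span hli)]

/-- The energy of a monomial in the creation operators: each factor `g_{-n}` contributes `n`. -/
def energy (m : Gen × ℕ+ →₀ ℕ) : ℕ := m.sum fun x e => e * x.2

lemma fockMode_zero (μ : Gen → ℂ) (g : Gen) (v : Fock) :
    fockMode μ g 0 v = (∑ h, form g h * μ h) • v := rfl

lemma sum_gen {M : Type*} [AddCommMonoid M] (f : Gen → M) : ∑ g, f g = f Gen.a + f Gen.d := by
  change ∑ g ∈ ({Gen.a, Gen.d} : Finset Gen), f g = _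
  rw [Finset.sum_pair (by simp)]

lemma fockPair_monomial (μ : Gen → ℂ) (n : ℕ) (m : Gen × ℕ+ →₀ ℕ) :
    fockPair μ n (MvPolynomial.monomial m 1) =
      (2 * ∑ g, (m (g, n.succPNat) : ℂ) * (n.succPNat : ℕ)) • MvPolynomial.monomial m (1 : ℂ) := by
  have hX : ∀ g : Gen, MvPolynomial.X (g, n.succPNat) *
      MvPolynomial.pderiv (g, n.succPNat) (MvPolynomial.monomial m (1 : ℂ)) =
        (m (g, n.succPNat) : ℂ) • MvPolynomial.monomial m (1 : ℂ) := fun g => by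
    rw [MvPolynomial.X_mul_pderiv_monomial, Nat.cast_smul_eq_nsmul]
  simp only [fockPair, fockMode, LinearMap.add_apply, Module.End.mul_apply, LinearMap.smul_apply,
    LinearMap.mulLeft_apply, sum_gen, form, mul_smul_comm, mul_add]
  simp [hX, smul_smul, -MvPolynomial.pderiv_monomial]
  rw [← add_smul]
  congr 1
  ring

lemma finsum_energy (m : Gen × ℕ+ →₀ ℕ) :
    ∑ᶠ n : ℕ, ∑ g, (m (g, n.succPNat) : ℂ) * (n.succPNat : ℕ) = energy m := by
  classical
  set T : Finset ℕ+ := m.support.image Prod.snd with hT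
  have hmem : ∀ g (n : ℕ+), n ∉ T → m (g, n) = 0 := by
    intro g n hn
    by_contra h0
    exact hn (Finset.mem_image.2 ⟨(g, n), Finsupp.mem_support_iff.2 h0, rfl⟩)
  rw [finsum_eq_sum_of_support_subset (s := T.image PNat.natPred)]
  · rw [Finset.sum_image (fun a _ b _ h => PNat.natPred_injective h)]
    rw [energy, Finsupp.sum_of_support_subset m (s := Finset.univ ×ˢ T)]
    · rw [Finset.sum_product_right]
      push_cast
      simp
    · intro x hx
      simp only [Finset.mem_product, Finset.mem_univ, true_and]
      exact Finset.mem_image_of_mem _ hx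
    · simp
  · intro n hn
    by_contra hmem'
    refine hn (Finset.sum_eq_zero fun g _ => ?_)
    rw [hmem, Nat.cast_zero, zero_mul]
    intro h
    refine hmem' ?_
    simp only [Finset.coe_image, Set.mem_image, Finset.mem_coe]
    exact ⟨_, h, by simp⟩

lemma fockT_monomial (k : ℂ) (ℓ : ℤ) (lam : ℝ) (m : Gen × ℕ+ →₀ ℕ) :
    fockT k (weight ℓ lam) (MvPolynomial.monomial m 1) =
      (ℓ * lam - k / 3 * (ℓ - 1) + energy m) • MvPolynomial.monomial m (1 : ℂ) := by
  have h1 : locallyFiniteSum (fockPair (weight ℓ lam)) (finite_support_fockPair _)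
      (MvPolynomial.monomial m 1) = (2 * (energy m : ℂ)) • MvPolynomial.monomial m (1 : ℂ) := by
    change ∑ᶠ n : ℕ, fockPair (weight ℓ lam) n (MvPolynomial.monomial m 1) = _
    simp only [fockPair_monomial]
    rw [← finsum_energy, ← finsum_smul, ← smul_eq_mul, smul_finsum]
    rfl
  simp only [fockT, fockNormalOrderedAD, LinearMap.add_apply, LinearMap.sub_apply,
    LinearMap.smul_apply, Module.End.mul_apply, h1, fockMode_zero, smul_smul, map_smul]
  rw [← add_smul, smul_smul, ← sub_smul, ← add_smul]
  congr 1
  simp [sum_gen, form, weight]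
  ring

/-- The basis of `Π_ν^ℓ` consisting of the monomials in the creation operators, applied to the
highest-weight vectors of the Fock spaces. -/
def monomialBasis (ν : UnitAddCircle) :
    Module.Basis (Σ _ : Coset ν, Gen × ℕ+ →₀ ℕ) ℂ (HalfLatticeModule ν) :=
  DFinsupp.basis fun _ => MvPolynomial.basisMonomials _ ℂ

open Classical in
lemma monomialBasis_apply (ν : UnitAddCircle) (lam : Coset ν) (m : Gen × ℕ+ →₀ ℕ) :
    monomialBasis ν ⟨lam, m⟩ =
      DirectSum.lof ℂ (Coset ν) (fun _ => Fock) lam (MvPolynomial.monomial m 1) := by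
  rw [Module.Basis.apply_eq_iff]
  simp only [monomialBasis, DFinsupp.basis, LinearEquiv.trans_apply]
  rw [LinearEquiv.symm_apply_eq]
  ext i x
  change (MvPolynomial.basisMonomials (Gen × ℕ+) ℂ).repr
    (DFinsupp.single (β := fun _ : Coset ν => Fock) lam (MvPolynomial.monomial m 1) i) x =
      sigmaFinsuppEquivDFinsupp (Finsupp.single (⟨lam, m⟩ : Σ _ : Coset ν, Gen × ℕ+ →₀ ℕ) 1) i x
  have hm : (MvPolynomial.monomial m (1 : ℂ)) = MvPolynomial.basisMonomials (Gen × ℕ+) ℂ m := by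
    simp
  rw [sigmaFinsuppEquivDFinsupp_single]
  rcases eq_or_ne lam i with rfl | hi
  · rw [DFinsupp.single_eq_same, DFinsupp.single_eq_same, hm, Module.Basis.repr_self]
  · rw [DFinsupp.single_eq_of_ne hi.symm, DFinsupp.single_eq_of_ne hi.symm, map_zero]

lemma lmap_monomialBasis {ν : UnitAddCircle} {f : Coset ν → Module.End ℂ Fock} {lam : Coset ν}
    {m : Gen × ℕ+ →₀ ℕ} {c : ℂ}
    (hf : f lam (MvPolynomial.monomial m 1) = c • MvPolynomial.monomial m 1) :
    DirectSum.lmap f (monomialBasis ν ⟨lam, m⟩) = c • monomialBasis ν ⟨lam, m⟩ := by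
  classical
  rw [monomialBasis_apply, DirectSum.lmap_lof, hf, map_smul]

/-- The joint eigenspaces of `a₀`, `d₀`, `T₀` on `Π_ν^ℓ`: the Fock space of `λ` has `a₀ = ℓ - 1`
and `d₀ = 2λ`, and its monomials of energy `N` have `T₀ = ℓλ - (k/3)(ℓ - 1) + N`. -/
lemma multiplicity_module (k : ℂ) (ν : UnitAddCircle) (ℓ : ℤ) (x y z : ℂ) :
    multiplicity (moduleMode ν ℓ Gen.a 0) (moduleMode ν ℓ Gen.d 0) (moduleT k ν ℓ) x y z =
      Nat.card {i : Σ _ : Coset ν, Gen × ℕ+ →₀ ℕ //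
        (ℓ : ℂ) - 1 = x ∧ 2 * ((i.1 : ℝ) : ℂ) = y ∧
          ℓ * ((i.1 : ℝ) : ℂ) - k / 3 * (ℓ - 1) + energy i.2 = z} := by
  refine multiplicity_eq_card (monomialBasis ν) (α := fun _ => (ℓ : ℂ) - 1)
    (β := fun i => 2 * ((i.1 : ℝ) : ℂ))
    (h := fun i => ℓ * ((i.1 : ℝ) : ℂ) - k / 3 * (ℓ - 1) + energy i.2) ?_ ?_ ?_ x y z
  · rintro ⟨lam, m⟩
    refine lmap_monomialBasis ?_
    rw [fockMode_zero]
    congr 1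
    simp [sum_gen, form, weight]
    ring
  · rintro ⟨lam, m⟩
    refine lmap_monomialBasis ?_
    rw [fockMode_zero]
    congr 1
    simp [sum_gen, form, weight]
  · rintro ⟨lam, m⟩
    exact lmap_monomialBasis (fockT_monomial k ℓ lam m)

/-! ### Graded dimension of the Fock space -/

/-- Multi-indices supported on `insert x s` are pairs of an exponent of `x` and a multi-index
supported on `s`. -/
def supportInsertEquiv {σ : Type*} [DecidableEq σ] {x : σ} {s : Finset σ} (hx : x ∉ s) :
    {m : σ →₀ ℕ // m.support ⊆ insert x s} ≃ ℕ × {m : σ →₀ ℕ // m.support ⊆ s} where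
  toFun m := (m.1 x, ⟨m.1.erase x, by
    rw [Finsupp.support_erase]
    exact (Finset.erase_subset_erase x m.2).trans (Finset.erase_insert_subset x s)⟩)
  invFun p := ⟨p.2.1.update x p.1, by
    refine (Finsupp.support_update_subset _ _).trans ?_
    exact Finset.insert_subset_insert x p.2.2⟩
  left_inv m := by
    ext y
    rcases eq_or_ne y x with rfl | hy
    · simp
    · simp [hy, Finsupp.update, Function.update_of_ne]
  right_inv p := by
    have h0 : p.2.1 x = 0 := by
      by_contra h
      exact hx (p.2.2 (Finsupp.mem_support_iff.2 h))
    refine Prod.ext (by simp) (Subtype.ext ?_)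
    ext y
    rcases eq_or_ne y x with rfl | hy
    · simp [h0]
    · simp [hy]

/-- The expansion of a finite product of geometric series as a sum over multi-indices. -/
lemma hasSum_prod_pow_of_support_subset {σ 𝕜 : Type*} [DecidableEq σ] [NormedField 𝕜]
    [CompleteSpace 𝕜] {f : σ → 𝕜} (hf : ∀ x, ‖f x‖ < 1) (s : Finset σ) :
    (Summable fun m : {m : σ →₀ ℕ // m.support ⊆ s} => ‖m.1.prod fun x e => f x ^ e‖) ∧
    HasSum (fun m : {m : σ →₀ ℕ // m.support ⊆ s} => m.1.prod fun x e => f x ^ e)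
      (∏ x ∈ s, (1 - f x)⁻¹) := by
  induction s using Finset.induction_on with
  | empty =>
    let _ : Unique {m : σ →₀ ℕ // m.support ⊆ (∅ : Finset σ)} :=
      { default := ⟨0, by simp⟩
        uniq := fun m => Subtype.ext (by simpa using m.2) }
    refine ⟨(hasSum_unique _).summable, ?_⟩
    have h := hasSum_unique fun m : {m : σ →₀ ℕ // m.support ⊆ (∅ : Finset σ)} =>
      m.1.prod fun x e => f x ^ e
    have hd : (default : {m : σ →₀ ℕ // m.support ⊆ (∅ : Finset σ)}).1 = 0 := rfl
    rwa [hd, Finsupp.prod_zero_index] at h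
  | insert x s hx ih =>
    have hgeo := hasSum_geometric_of_norm_lt_one (hf x)
    have hgeon : Summable fun n : ℕ => ‖f x ^ n‖ := by
      simpa [norm_pow] using summable_geometric_of_lt_one (norm_nonneg _) (hf x)
    have hcomp : (fun m : {m : σ →₀ ℕ // m.support ⊆ insert x s} => m.1.prod fun x e => f x ^ e) =
        (fun p : ℕ × {m : σ →₀ ℕ // m.support ⊆ s} =>
          f x ^ p.1 * p.2.1.prod fun x e => f x ^ e) ∘ supportInsertEquiv hx := by
      funext m
      exact (Finsupp.mul_prod_erase' m.1 x (fun x e => f x ^ e) (by simp)).symm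
    rw [hcomp, (supportInsertEquiv hx).hasSum_iff, Finset.prod_insert hx]
    constructor
    · have h := (supportInsertEquiv hx).summable_iff.2 (hgeon.mul_norm ih.1)
      exact h.congr fun m => congrArg norm (congrFun hcomp m).symm
    · set G : {m : σ →₀ ℕ // m.support ⊆ s} → 𝕜 := fun m => m.1.prod fun x e => f x ^ e
      have hsum : Summable fun p : ℕ × {m : σ →₀ ℕ // m.support ⊆ s} => f x ^ p.1 * G p.2 :=
        (hgeon.mul_norm ih.1).of_norm
      have hG : HasSum G (∏ x ∈ s, (1 - f x)⁻¹) := ih.2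
      have h := hgeo.mul_eq hG hsum.hasSum
      rw [h]
      exact hsum.hasSum

lemma norm_prod_pow {σ : Type*} (f : σ → ℂ) (m : σ →₀ ℕ) :
    ‖m.prod fun x e => f x ^ e‖ = m.prod fun x e => ‖f x‖ ^ e := by
  simp [Finsupp.prod, norm_prod]

/-- The partial sums are dominated by the infinite product of the geometric series of the
norms. -/
lemma summable_norm_prod_pow {σ : Type*} {f : σ → ℂ} {ρ : ℝ} (hρ : ρ < 1) (hf : ∀ x, ‖f x‖ ≤ ρ)
    (hs : Summable fun x => ‖f x‖) :
    Summable fun m : σ →₀ ℕ => ‖m.prod fun x e => f x ^ e‖ := by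
  classical
  have hpos : ∀ x, 0 < 1 - ‖f x‖ := fun x => by linarith [hf x]
  have hle : ∀ x, (1 - ‖f x‖)⁻¹ ≤ Real.exp ((1 - ρ)⁻¹ * ‖f x‖) := by
    intro x
    have h1 : (1 - ‖f x‖)⁻¹ = 1 + (1 - ‖f x‖)⁻¹ * ‖f x‖ := by
      have := (hpos x).ne'
      field_simp
      ring
    have h2 : (1 - ‖f x‖)⁻¹ ≤ (1 - ρ)⁻¹ := inv_anti₀ (by linarith) (by linarith [hf x])
    calc (1 - ‖f x‖)⁻¹ = 1 + (1 - ‖f x‖)⁻¹ * ‖f x‖ := h1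
      _ ≤ (1 - ρ)⁻¹ * ‖f x‖ + 1 := by nlinarith [norm_nonneg (f x)]
      _ ≤ _ := Real.add_one_le_exp _
  refine summable_of_sum_le (c := Real.exp ((1 - ρ)⁻¹ * ∑' x, ‖f x‖))
    (fun _ => norm_nonneg _) fun u => ?_
  set s : Finset σ := u.biUnion Finsupp.support
  have hu : ∀ m ∈ u, m.support ⊆ s := fun m hm => Finset.subset_biUnion_of_mem _ hm
  have hS := hasSum_prod_pow_of_support_subset (f := fun x => ‖f x‖)
    (fun x => by rw [norm_norm]; linarith [hf x]) s
  calc ∑ m ∈ u, ‖m.prod fun x e => f x ^ e‖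
      = ∑ m ∈ u.subtype fun m => m.support ⊆ s, m.1.prod fun x e => ‖f x‖ ^ e := by
        rw [Finset.sum_subtype_of_mem (fun m : σ →₀ ℕ => m.prod fun x e => ‖f x‖ ^ e) hu]
        exact Finset.sum_congr rfl fun m _ => norm_prod_pow f m
    _ ≤ ∏ x ∈ s, (1 - ‖f x‖)⁻¹ := by
        refine sum_le_hasSum _ (fun m _ => ?_) hS.2
        exact Finset.prod_nonneg fun x _ => by positivity
    _ ≤ ∏ x ∈ s, Real.exp ((1 - ρ)⁻¹ * ‖f x‖) :=
        Finset.prod_le_prod (fun x _ => (inv_pos.2 (hpos x)).le) fun x _ => hle x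
    _ = Real.exp ((1 - ρ)⁻¹ * ∑ x ∈ s, ‖f x‖) := by rw [← Real.exp_sum, Finset.mul_sum]
    _ ≤ _ := by
        have h1 : 0 ≤ (1 - ρ)⁻¹ := inv_nonneg.2 (by linarith)
        have h2 := hs.sum_le_tsum s (fun _ _ => norm_nonneg _)
        gcongr

/-- The sum over all multi-indices is the product of the geometric series. -/
lemma hasProd_geometric {σ : Type*} {f : σ → ℂ} {ρ : ℝ} (hρ : ρ < 1) (hf : ∀ x, ‖f x‖ ≤ ρ)
    (hs : Summable fun x => ‖f x‖) :
    HasProd (fun x => (1 - f x)⁻¹) (∑' m : σ →₀ ℕ, m.prod fun x e => f x ^ e) := by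
  classical
  have hlim : Filter.Tendsto (fun s : Finset σ => ∑' m : σ →₀ ℕ,
      Set.indicator {m : σ →₀ ℕ | m.support ⊆ s} (fun m => m.prod fun x e => f x ^ e) m)
      Filter.atTop (nhds (∑' m : σ →₀ ℕ, m.prod fun x e => f x ^ e)) := by
    refine tendsto_tsum_of_dominated_convergence (summable_norm_prod_pow hρ hf hs) (fun m => ?_)
      (Filter.Eventually.of_forall fun s m => norm_indicator_le_norm_self _ _)
    refine tendsto_const_nhds.congr' ?_
    filter_upwards [Filter.eventually_ge_atTop m.support] with s hms
    rw [Set.indicator_of_mem]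
    exact hms
  refine hlim.congr fun s => ?_
  rw [← tsum_subtype]
  exact (hasSum_prod_pow_of_support_subset (fun x => (hf x).trans_lt hρ) s).2.tsum_eq

lemma pow_energy (q : ℂ) (m : Gen × ℕ+ →₀ ℕ) :
    q ^ energy m = m.prod fun x e => (q ^ (x.2 : ℕ)) ^ e := by
  rw [energy, Finsupp.sum, ← Finset.prod_pow_eq_pow_sum, Finsupp.prod]
  exact Finset.prod_congr rfl fun x _ => by rw [← pow_mul, mul_comm]

lemma summable_pow_gen {r : ℝ} (h0 : 0 ≤ r) (h1 : r < 1) :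
    Summable fun x : Gen × ℕ+ => r ^ (x.2 : ℕ) := by
  have h : Summable fun n : ℕ+ => r ^ (n : ℕ) :=
    (summable_geometric_of_lt_one h0 h1).comp_injective PNat.coe_injective
  refine (summable_prod_of_nonneg fun _ => by positivity).2 ⟨fun _ => h, ?_⟩
  exact (hasSum_fintype _).summable

lemma norm_pow_pnat_le {q : ℂ} (hq : ‖q‖ < 1) (n : ℕ+) : ‖q ^ (n : ℕ)‖ ≤ ‖q‖ := by
  rw [norm_pow]
  exact pow_le_of_le_one (norm_nonneg _) hq.le n.ne_zero

lemma summable_norm_pow_energy {q : ℂ} (hq : ‖q‖ < 1) :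
    Summable fun m : Gen × ℕ+ →₀ ℕ => ‖q ^ energy m‖ := by
  simp only [pow_energy]
  exact summable_norm_prod_pow hq (fun x => norm_pow_pnat_le hq x.2)
    (by simpa [norm_pow] using summable_pow_gen (norm_nonneg q) hq)

/-- The generating function of two-coloured partitions. -/
lemma tsum_pow_energy {q : ℂ} (hq : ‖q‖ < 1) (h0 : ∏' n : ℕ, (1 - q ^ (n + 1)) ≠ 0) :
    ∑' m : Gen × ℕ+ →₀ ℕ, q ^ energy m = ((∏' n : ℕ, (1 - q ^ (n + 1))) ^ 2)⁻¹ := by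
  have h1 : HasProd (fun n : ℕ+ => (1 - q ^ (n : ℕ))⁻¹) (∏' n : ℕ, (1 - q ^ (n + 1)))⁻¹ := by
    have h := ((ModularForm.multipliable_one_sub_pow hq).hasProd).inv₀ h0
    rw [← Equiv.pnatEquivNat.hasProd_iff] at h
    refine h.congr_fun ?_
    intro n
    simp
  have h2 := hasProd_geometric (f := fun x : Gen × ℕ+ => q ^ (x.2 : ℕ)) hq
    (fun x => norm_pow_pnat_le hq x.2)
    (by simpa [norm_pow] using summable_pow_gen (norm_nonneg q) hq)
  have h3 := (h2.prod_fiberwise fun g => h1).unique (hasProd_fintype _)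
  simp only [pow_energy]
  rw [h3]
  have hcard : Fintype.card Gen = 2 := rfl
  simp [hcard]

/-- The Dedekind eta function computes the graded dimension of the Fock space. -/
lemma hasSum_exp_energy (τ : ℍ) :
    HasSum (fun m : Gen × ℕ+ →₀ ℕ =>
        Complex.exp (2 * Real.pi * Complex.I * (((energy m : ℂ) - 1 / 12) * τ)))
      (1 / (η τ) ^ 2) := by
  set q : ℂ := Complex.exp (2 * Real.pi * Complex.I * τ) with hq
  have hq1 : ‖q‖ < 1 := UpperHalfPlane.norm_exp_two_pi_I_lt_one τ
  have h0 : ∏' n : ℕ, (1 - q ^ (n + 1)) ≠ 0 := by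
    simpa only [ModularForm.eta_q_eq_pow] using ModularForm.eta_tprod_ne_zero τ.2
  have hsum := (summable_norm_pow_energy hq1).of_norm.hasSum
  rw [tsum_pow_energy hq1 h0] at hsum
  have heta : η τ = Complex.exp (2 * Real.pi * Complex.I * τ / 24) *
      ∏' n : ℕ, (1 - q ^ (n + 1)) := by
    simp only [ModularForm.eta, ModularForm.eta_q_eq_pow, Function.Periodic.qParam]
    norm_num [hq]
  have hexp : Complex.exp (2 * Real.pi * Complex.I * τ / 24) ^ 2 =
      (Complex.exp (2 * Real.pi * Complex.I * (-(1 / 12) * τ)))⁻¹ := by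
    rw [← Complex.exp_nat_mul, ← Complex.exp_neg]
    congr 1
    push_cast
    ring
  rw [heta, mul_pow, hexp, one_div (_ * _), mul_inv, inv_inv]
  refine (hsum.mul_left _).congr_fun ?_
  intro m
  rw [hq, ← Complex.exp_nat_mul, ← Complex.exp_add]
  congr 1
  ring

/-! ### Terms of the trace -/

/-- A sum over the values of `g`, weighted by the sizes of its fibres, is the sum over its domain.
Infinite fibres, which `Nat.card` counts as `0`, occur only where `F` vanishes. -/
lemma tsum_card_fiber_mul {ι κ : Type*} (g : ι → κ) (F : κ → ℂ) {S : ℂ}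
    (h : HasSum (fun i => F (g i)) S) :
    ∑' p : κ, (Nat.card {i // g i = p} : ℂ) * F p = S := by
  rw [← (Equiv.sigmaFiberEquiv g).hasSum_iff] at h
  have hconst : ∀ p (i : {i // g i = p}), F (g i) = F p := fun p i => congrArg F i.2
  have h2 := h.sigma fun p => (h.summable.sigma_factor p).hasSum
  rw [← h2.tsum_eq]
  refine tsum_congr fun p => ?_
  have h3 : ∑' c : {i // g i = p}, ((fun i => F (g i)) ∘ Equiv.sigmaFiberEquiv g) ⟨p, c⟩ =
      ∑' _ : {i // g i = p}, F p := tsum_congr fun i => hconst p i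
  rw [h3, tsum_const, nsmul_eq_mul]

/-- The factor of the character which depends on neither `ν` nor `ζd`. -/
def prefactor (k : ℂ) (ℓ : ℤ) (ζa τ : ℂ) : ℂ :=
  Complex.exp (2 * Real.pi * Complex.I * (ζa * ((ℓ : ℂ) - 1))) *
    Complex.exp (-(2 * Real.pi * Complex.I * (k * ℓ * τ / 3))) / (η τ) ^ 2

lemma prefactor_ne_zero (k : ℂ) (ℓ : ℤ) (ζa : ℂ) (τ : ℍ) : prefactor k ℓ ζa τ ≠ 0 :=
  div_ne_zero (mul_ne_zero (Complex.exp_ne_zero _) (Complex.exp_ne_zero _))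
    (pow_ne_zero _ (ModularForm.eta_ne_zero τ.2))

/-- The contribution of a single Fock space to the trace. -/
lemma traceTerm_two_mul (k : ℂ) (ν : UnitAddCircle) (ℓ : ℤ) (ζa ζd : ℂ) (τ : ℍ) (lam : Coset ν) :
    traceTerm (moduleMode ν ℓ Gen.a 0) (moduleMode ν ℓ Gen.d 0) (moduleT k ν ℓ)
        (centralCharge k) ζa ζd τ (2 * ((lam : ℝ) : ℂ)) =
      prefactor k ℓ ζa τ *
        Complex.exp (2 * Real.pi * Complex.I * ((lam : ℝ) * (2 * ζd + ℓ * τ))) := by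
  set g : (Gen × ℕ+ →₀ ℕ) → ℂ × ℂ := fun m =>
    ((ℓ : ℂ) - 1, ℓ * ((lam : ℝ) : ℂ) - k / 3 * (ℓ - 1) + energy m) with hg
  have hcard : ∀ p : ℂ × ℂ, multiplicity (moduleMode ν ℓ Gen.a 0) (moduleMode ν ℓ Gen.d 0)
      (moduleT k ν ℓ) p.1 (2 * ((lam : ℝ) : ℂ)) p.2 = Nat.card {m // g m = p} := by
    intro p
    rw [multiplicity_module]
    refine Nat.card_congr
      { toFun := fun i => ⟨i.1.2, ?_⟩
        invFun := fun m => ⟨⟨lam, m.1⟩, ?_⟩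
        left_inv := ?_
        right_inv := fun m => rfl }
    · have hl : i.1.1 = lam := by
        have := i.2.2.1
        exact Subtype.ext (by simpa using this)
      refine Prod.ext i.2.1 ?_
      refine Eq.trans ?_ i.2.2.2
      rw [hl]
    · have := m.2
      exact ⟨congrArg Prod.fst this, rfl, congrArg Prod.snd this⟩
    · rintro ⟨⟨lam', m⟩, h⟩
      have hl : lam' = lam := Subtype.ext (by simpa using h.2.1)
      subst hl
      rfl
  have hsum : HasSum (fun m => Complex.exp (2 * Real.pi * Complex.I *
      ((g m).1 * ζa + ((g m).2 - centralCharge k / 24) * τ)))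
      (Complex.exp (2 * Real.pi * Complex.I * ((ℓ - 1) * ζa + (ℓ * (lam : ℝ) - k * ℓ / 3) * τ)) *
        (1 / (η τ) ^ 2)) := by
    refine ((hasSum_exp_energy τ).mul_left _).congr_fun fun m => ?_
    rw [← Complex.exp_add]
    congr 1
    simp only [hg, centralCharge]
    ring
  have htsum := tsum_card_fiber_mul g (fun p : ℂ × ℂ => Complex.exp (2 * Real.pi * Complex.I *
      (p.1 * ζa + (p.2 - centralCharge k / 24) * τ))) hsum
  rw [traceTerm]
  simp only [hcard]
  rw [htsum, prefactor, ← Complex.exp_add, div_mul_eq_mul_div, ← Complex.exp_add,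
    mul_one_div, div_mul_eq_mul_div, ← Complex.exp_add]
  congr 2
  ring

/-- Only the eigenvalues `2λ` of `d₀`, for `λ ∈ ν`, contribute to the trace. -/
lemma traceTerm_eq_zero (k : ℂ) {ν : UnitAddCircle} (ℓ : ℤ) (c ζa ζd τ : ℂ) {β : ℂ}
    (hβ : ∀ lam : Coset ν, 2 * ((lam : ℝ) : ℂ) ≠ β) :
    traceTerm (moduleMode ν ℓ Gen.a 0) (moduleMode ν ℓ Gen.d 0) (moduleT k ν ℓ)
      c ζa ζd τ β = 0 := by
  have h : ∀ p : ℂ × ℂ, multiplicity (moduleMode ν ℓ Gen.a 0) (moduleMode ν ℓ Gen.d 0)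
      (moduleT k ν ℓ) p.1 β p.2 = 0 := by
    intro p
    rw [multiplicity_module]
    have : IsEmpty {i : Σ _ : Coset ν, Gen × ℕ+ →₀ ℕ // (ℓ : ℂ) - 1 = p.1 ∧
        2 * ((i.1 : ℝ) : ℂ) = β ∧ ℓ * ((i.1 : ℝ) : ℂ) - k / 3 * (ℓ - 1) + energy i.2 = p.2} :=
      ⟨fun i => hβ i.1.1 i.2.2.1⟩
    exact Nat.card_of_isEmpty
  simp [traceTerm, h]

lemma exists_eq_add_int {x : ℝ} (lam : Coset (x : UnitAddCircle)) :
    ∃ n : ℤ, (lam : ℝ) = x + n := by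
  have h : ((lam - x : ℝ) : UnitAddCircle) = 0 := by
    rw [AddCircle.coe_sub, lam.2, sub_self]
  obtain ⟨n, hn⟩ := AddCircle.coe_eq_zero_iff 1 |>.1 h
  rw [zsmul_one] at hn
  exact ⟨n, by linarith⟩

lemma norm_exp_two_pi_I_mul (x : ℝ) (w : ℂ) :
    ‖Complex.exp (2 * Real.pi * Complex.I * (x * w))‖ = Real.exp (-(2 * Real.pi * x * w.im)) := by
  rw [Complex.norm_exp]
  congr 1
  simp
  ring

/-- The terms of the trace are bounded exactly where `2 s ζd + ℓ τ` is real. -/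
lemma boundedLocus_eq (k : ℂ) (ν : UnitAddCircle) (ℓ : ℤ) (ζa s : ℂ) (τ : ℍ) :
    boundedLocus (moduleMode ν ℓ Gen.a 0) (moduleMode ν ℓ Gen.d 0) (moduleT k ν ℓ)
      (centralCharge k) ζa τ (fun ζd => s * ζd) = {z | (2 * s * z + ℓ * τ).im = 0} := by
  ext z
  have hnorm : ∀ lam : Coset ν, ‖traceTerm (moduleMode ν ℓ Gen.a 0) (moduleMode ν ℓ Gen.d 0)
      (moduleT k ν ℓ) (centralCharge k) ζa (s * z) τ (2 * ((lam : ℝ) : ℂ))‖ =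
      ‖prefactor k ℓ ζa τ‖ * Real.exp (-(2 * Real.pi * lam * (2 * s * z + ℓ * τ).im)) := by
    intro lam
    rw [traceTerm_two_mul, norm_mul, norm_exp_two_pi_I_mul, mul_assoc 2 s z]
  set y : ℝ := (2 * s * z + ℓ * τ).im with hy
  change (∃ B : ℝ, ∀ β : ℂ, _) ↔ y = 0
  constructor
  · rintro ⟨B, hB⟩
    by_contra hy0
    obtain ⟨x, rfl⟩ := QuotientAddGroup.mk_surjective ν
    have hp : 0 < ‖prefactor k ℓ ζa τ‖ := norm_pos_iff.2 (prefactor_ne_zero k ℓ ζa τ)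
    -- The coset is unbounded in both directions, so the exponent takes arbitrarily large values.
    obtain ⟨n, hn⟩ : ∃ n : ℤ, B / ‖prefactor k ℓ ζa τ‖ ≤ -(2 * Real.pi * (x + n) * y) := by
      have h2 : 0 < 2 * Real.pi * |y| := by positivity
      set R : ℝ := (B / ‖prefactor k ℓ ζa τ‖ + 2 * Real.pi * x * y) / (2 * Real.pi * |y|)
      have hR : R * (2 * Real.pi * |y|) = B / ‖prefactor k ℓ ζa τ‖ + 2 * Real.pi * x * y :=
        div_mul_cancel₀ _ h2.ne'
      have hc := mul_le_mul_of_nonneg_right (Int.le_ceil R) h2.le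
      rcases lt_or_gt_of_ne hy0 with h | h
      · refine ⟨⌈R⌉, ?_⟩
        rw [abs_of_neg h] at hc hR
        linarith
      · refine ⟨-⌈R⌉, ?_⟩
        rw [abs_of_pos h] at hc hR
        push_cast
        linarith
    have h1 := hB (2 * (((x + n : ℝ)) : ℂ))
    rw [hnorm ⟨x + n, by simp⟩] at h1
    have h3 := Real.add_one_le_exp (-(2 * Real.pi * (x + n) * y))
    rw [div_le_iff₀ hp] at hn
    nlinarith
  · intro hy0
    refine ⟨‖prefactor k ℓ ζa τ‖, fun β => ?_⟩
    by_cases hβ : ∃ lam : Coset ν, 2 * ((lam : ℝ) : ℂ) = β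
    · obtain ⟨lam, rfl⟩ := hβ
      rw [hnorm, hy0]
      simp
    · push Not at hβ
      rw [traceTerm_eq_zero k ℓ _ _ _ _ hβ, norm_zero]
      exact norm_nonneg _

/-! ### Poisson summation along the line of convergence -/

lemma diracComb_apply (w : ℤ → ℂ) {α : ℂ} (β : ℂ) (hα : α ≠ 0)
    (φ : 𝓓((⊤ : TopologicalSpace.Opens ℂ), ℂ)) :
    diracComb w α β hα φ = ∑ᶠ n : ℤ, w n * ((‖α‖⁻¹ : ℂ) * φ ((n - β) / α)) := by
  change ∑ᶠ n : ℤ, w n * ((‖α‖⁻¹ : ℂ) * φ (-(β - n) / α)) = _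
  simp only [neg_sub]

lemma character_apply (k : ℂ) (ν : UnitAddCircle) (ℓ : ℤ) (ζa : ℂ) {s : ℂ} (τ : ℂ) (hs : s ≠ 0)
    (φ : 𝓓((⊤ : TopologicalSpace.Opens ℂ), ℂ)) :
    character k ν ℓ ζa s τ hs φ = prefactor k ℓ ζa τ *
      ∑ᶠ n : ℤ, fourier n ν * ((‖2 * s‖⁻¹ : ℂ) * φ ((n - ℓ * τ) / (2 * s))) := by
  rw [← diracComb_apply _ _ (mul_ne_zero two_ne_zero hs)]
  rfl

lemma finite_support_comb {α : ℂ} (hα : α ≠ 0) (β : ℂ) (w : ℤ → ℂ)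
    (φ : 𝓓((⊤ : TopologicalSpace.Opens ℂ), ℂ)) :
    (Function.support fun n : ℤ => w n * ((‖α‖⁻¹ : ℂ) * φ ((n - β) / α))).Finite := by
  have h := finite_support_dirac hα β w φ
  change (Function.support fun n : ℤ => w n * ((‖α‖⁻¹ : ℂ) * φ (-(β - n) / α))).Finite at h
  simpa only [neg_sub] using h

/-- Arc length parametrisation of the line on which `α z + β` is real, for `α ≠ 0`: it satisfies
`α z + β = |α| t`. -/
def lineParam (α β : ℂ) (t : ℝ) : ℂ := (‖α‖ * t - β) / α

lemma isometry_lineParam {α : ℂ} (hα : α ≠ 0) (β : ℂ) : Isometry (lineParam α β) := by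
  refine Isometry.of_dist_eq fun t u => ?_
  have h : lineParam α β t - lineParam α β u = (‖α‖ / α) * ((t - u : ℝ) : ℂ) := by
    simp only [lineParam]
    push_cast
    ring
  have h2 : ‖α‖ ≠ 0 := norm_ne_zero_iff.2 hα
  rw [dist_eq_norm, h, norm_mul, norm_div, Complex.norm_real, Complex.norm_real, norm_norm,
    div_self h2, one_mul, dist_eq_norm]

lemma mul_lineParam {α : ℂ} (hα : α ≠ 0) (β : ℂ) (t : ℝ) :
    α * lineParam α β t + β = ((‖α‖ * t : ℝ) : ℂ) := by
  rw [lineParam, mul_div_cancel₀ _ hα]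
  push_cast
  ring

lemma range_lineParam {α : ℂ} (hα : α ≠ 0) (β : ℂ) :
    Set.range (lineParam α β) = {z | (α * z + β).im = 0} := by
  ext z
  constructor
  · rintro ⟨t, rfl⟩
    change (α * lineParam α β t + β).im = 0
    rw [mul_lineParam hα, Complex.ofReal_im]
  · intro hz
    refine ⟨(α * z + β).re / ‖α‖, ?_⟩
    have h2 : (‖α‖ : ℂ) ≠ 0 := by simpa using hα
    have h3 : ((α * z + β).re : ℂ) = α * z + β :=
      Complex.ext (by simp) (by simpa using Eq.symm hz)
    rw [lineParam, Complex.ofReal_div, mul_div_cancel₀ _ h2, h3, add_sub_cancel_right,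
      mul_div_cancel_left₀ _ hα]

/-- Arc length on the line on which `α z + β` is real. -/
lemma hausdorffMeasure_restrict_line {α : ℂ} (hα : α ≠ 0) (β : ℂ) :
    (MeasureTheory.Measure.hausdorffMeasure 1 : MeasureTheory.Measure ℂ).restrict
      {z | (α * z + β).im = 0} = MeasureTheory.volume.map (lineParam α β) := by
  rw [← range_lineParam hα, ← (isometry_lineParam hα β).map_hausdorffMeasure (Or.inl zero_le_one),
    MeasureTheory.hausdorffMeasure_real]

lemma measurableEmbedding_lineParam {α : ℂ} (hα : α ≠ 0) (β : ℂ) :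
    MeasurableEmbedding (lineParam α β) :=
  (isometry_lineParam hα β).isClosedEmbedding.measurableEmbedding

/-- Poisson summation for a smooth function of compact support, twisted by a character. -/
lemma hasSum_integral_exp_mul {ψ : ℝ → ℂ} (hψ : ContDiff ℝ ∞ ψ) (hc : HasCompactSupport ψ)
    (x : ℝ) :
    HasSum (fun n : ℤ => ∫ t : ℝ, Complex.exp (2 * Real.pi * Complex.I * ((x + n : ℝ) * t)) * ψ t)
      (∑' n : ℤ, fourier n (x : UnitAddCircle) * ψ n) := by
  -- The frequency `x` is absorbed into the function, so that the sum runs over integers.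
  set F : ℝ → ℂ := fun t => Complex.exp (2 * Real.pi * Complex.I * (x * t)) * ψ t with hF
  have hFs : ContDiff ℝ ∞ F := by
    have : ContDiff ℝ ∞ (fun t : ℝ => (t : ℂ)) := Complex.ofRealCLM.contDiff
    exact ((contDiff_const.mul (contDiff_const.mul this)).cexp).mul hψ
  have hFc : HasCompactSupport F := hc.mul_left
  set f : SchwartzMap ℝ ℂ := hFc.toSchwartzMap hFs with hf
  have hP := f.tsum_eq_tsum_fourier 0
  have hsum : Summable fun n : ℤ => FourierTransform.fourier f (n : ℝ) :=
    summable_of_isBigO (Real.summable_abs_int_rpow one_lt_two)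
      (((FourierTransform.fourier f).isBigO_cocompact_rpow (-2)).comp_tendsto
        Int.tendsto_coe_cofinite)
  have hterm : ∀ n : ℤ, FourierTransform.fourier f ((-n : ℤ) : ℝ) =
      ∫ t : ℝ, Complex.exp (2 * Real.pi * Complex.I * ((x + n : ℝ) * t)) * ψ t := by
    intro n
    rw [SchwartzMap.fourier_coe, Real.fourier_real_eq_integral_exp_smul]
    congr 1
    funext t
    change _ • F t = _
    rw [hF, smul_eq_mul, ← mul_assoc, ← Complex.exp_add]
    congr 2
    push_cast
    ring
  have hval : ∀ n : ℤ, f (0 + n) = fourier n (x : UnitAddCircle) * ψ n := by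
    intro n
    change F (0 + n) = _
    simp only [hF, fourier_coe_apply, zero_add]
    congr 2
    push_cast
    ring
  have h := hsum.hasSum
  rw [← (Equiv.neg ℤ).hasSum_iff] at h
  simp only [hval] at hP
  rw [hP]
  simp only [← hterm]
  convert! h using 2
  simp

/-- The series of exponentials given by the trace converges to the Dirac comb. -/
lemma isDistributionalCharacter (k : ℂ) (ν : UnitAddCircle) (ℓ : ℤ) (ζa : ℂ) (τ : ℍ) (s : ℂ)
    (hs : s ≠ 0) :
    IsDistributionalCharacter (moduleMode ν ℓ Gen.a 0) (moduleMode ν ℓ Gen.d 0) (moduleT k ν ℓ)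
      (centralCharge k) ζa τ (fun ζd => s * ζd) (character k ν ℓ ζa s τ hs) := by
  intro φ
  have hα : 2 * s ≠ 0 := mul_ne_zero two_ne_zero hs
  have hα' : ‖2 * s‖ ≠ 0 := norm_ne_zero_iff.2 hα
  have hemb := measurableEmbedding_lineParam hα (ℓ * τ)
  rw [boundedLocus_eq]
  simp only [MeasureTheory.IntegrableOn, hausdorffMeasure_restrict_line hα]
  have hφc : HasCompactSupport (fun t => φ (lineParam (2 * s) (ℓ * τ) t)) :=
    φ.hasCompactSupport.comp_isClosedEmbedding (isometry_lineParam hα _).isClosedEmbedding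
  have hterm : ∀ (lam : Coset ν) (t : ℝ), traceTerm (moduleMode ν ℓ Gen.a 0)
      (moduleMode ν ℓ Gen.d 0) (moduleT k ν ℓ) (centralCharge k) ζa
      (s * lineParam (2 * s) (ℓ * τ) t) τ (2 * ((lam : ℝ) : ℂ)) =
        prefactor k ℓ ζa τ *
          Complex.exp (2 * Real.pi * Complex.I * ((lam : ℝ) * ((‖2 * s‖ * t : ℝ) : ℂ))) := by
    intro lam t
    rw [traceTerm_two_mul, ← mul_lineParam hα (ℓ * τ), mul_assoc 2 s]
  constructor
  · intro β
    rw [hemb.integrable_map_iff]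
    by_cases hβ : ∃ lam : Coset ν, 2 * ((lam : ℝ) : ℂ) = β
    · obtain ⟨lam, rfl⟩ := hβ
      refine Continuous.integrable_of_hasCompactSupport ?_ hφc.mul_left
      simp only [Function.comp_def, hterm]
      have h1 := (isometry_lineParam hα (ℓ * τ)).continuous
      have h2 : Continuous φ := φ.contDiff.continuous
      fun_prop
    · push Not at hβ
      refine (MeasureTheory.integrable_zero ℝ ℂ MeasureTheory.volume).congr ?_
      refine Filter.Eventually.of_forall fun t => ?_
      simp [traceTerm_eq_zero k ℓ _ _ _ _ hβ]
  · simp only [hemb.integral_map]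
    obtain ⟨x, rfl⟩ := QuotientAddGroup.mk_surjective ν
    set ψ : ℝ → ℂ := fun t => φ ((t - ℓ * τ) / (2 * s)) with hψ
    have hψs : ContDiff ℝ ∞ ψ := by
      refine φ.contDiff.comp ?_
      have : ContDiff ℝ ∞ (fun t : ℝ => (t : ℂ)) := Complex.ofRealCLM.contDiff
      exact (this.sub contDiff_const).div_const _
    have hψline : ∀ t, φ (lineParam (2 * s) (ℓ * τ) t) = ψ (‖2 * s‖ * t) := by
      intro t
      simp only [hψ, lineParam]
      push_cast
      rfl
    have hψc : HasCompactSupport ψ := by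
      have h := hφc.comp_homeomorph (Homeomorph.mulLeft₀ ‖2 * s‖⁻¹ (inv_ne_zero hα'))
      convert! h using 1
      funext t
      simp only [Function.comp_apply, hψline, Homeomorph.coe_mulLeft₀]
      rw [mul_inv_cancel_left₀ hα']
    have hinj : Function.Injective fun n : ℤ => 2 * ((x + n : ℝ) : ℂ) := by
      intro m n h
      simpa using h
    -- The `d₀`-eigenvalues are the numbers `2(x + n)`; every other `β` contributes `0`.
    rw [← hinj.hasSum_iff]
    · have hP := (hasSum_integral_exp_mul hψs hψc x).mul_left
        (prefactor k ℓ ζa τ * (‖2 * s‖⁻¹ : ℂ))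
      have hval : character k (x : UnitAddCircle) ℓ ζa s τ hs φ = prefactor k ℓ ζa τ *
          (‖2 * s‖⁻¹ : ℂ) * ∑' n : ℤ, fourier n (x : UnitAddCircle) * ψ n := by
        rw [character_apply, ← tsum_eq_finsum (L := .unconditional ℤ) (finite_support_comb hα _ _ φ), mul_assoc,
          ← tsum_mul_left (a := (‖2 * s‖⁻¹ : ℂ))]
        congr 1
        refine tsum_congr fun n => ?_
        simp only [hψ]
        push_cast
        ring
      change HasSum _ (character k (x : UnitAddCircle) ℓ ζa s τ hs φ)
      rw [hval]
      refine hP.congr_fun fun n => ?_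
      have hmem : ((x + n : ℝ) : UnitAddCircle) = x := by simp
      have h1 := hterm ⟨x + n, hmem⟩
      simp only [Function.comp_apply]
      simp only [] at h1
      simp only [h1, hψline, mul_assoc]
      rw [MeasureTheory.integral_const_mul,
        MeasureTheory.Measure.integral_comp_mul_left (fun y : ℝ =>
          Complex.exp (2 * (Real.pi * (Complex.I * (((x + n : ℝ) : ℂ) * (y : ℂ))))) * ψ y)]
      rw [abs_inv, abs_norm, Complex.real_smul]
      push_cast
      rfl
    · intro β hβ
      have h0 : ∀ lam : Coset (x : UnitAddCircle), 2 * ((lam : ℝ) : ℂ) ≠ β := by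
        rintro lam rfl
        obtain ⟨n, hn⟩ := exists_eq_add_int lam
        exact hβ ⟨n, by simp only [hn]⟩
      have h1 : ∀ ζd, traceTerm (moduleMode (x : UnitAddCircle) ℓ Gen.a 0)
          (moduleMode (x : UnitAddCircle) ℓ Gen.d 0) (moduleT k (x : UnitAddCircle) ℓ)
          (centralCharge k) ζa ζd τ β = 0 := fun ζd => traceTerm_eq_zero k ℓ _ _ _ _ h0
      refine (MeasureTheory.integral_congr_ae (Filter.Eventually.of_forall fun t => ?_)).trans
        (MeasureTheory.integral_zero ℝ ℂ)
      exact (congrArg (· * _) (h1 _)).trans (zero_mul _)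

/-! ### The modular S-transformation -/

/-- The square of the transformation law of the eta function: the square roots disappear. -/
lemma eta_neg_one_div_sq (τ : ℍ) : η (-1 / (τ : ℂ)) ^ 2 = -Complex.I * τ * η τ ^ 2 := by
  have h := ModularForm.eta_comp_eq_csqrt_I_inv τ.2
  have hsq : ∀ z : ℂ, Complex.sqrt z ^ 2 = z := fun z => by simp [Complex.sqrt]
  simp only [Function.comp_apply, Pi.smul_apply, Pi.mul_apply, smul_eq_mul] at h
  rw [h, mul_pow, mul_pow, inv_pow, hsq, hsq, Complex.inv_I, mul_assoc]

lemma integral_fourier_mul_fourier (m n : ℤ) :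
    ∫ x : UnitAddCircle, fourier (-m) x * fourier n x = if n = m then 1 else 0 := by
  have h := congrFun (fourierCoeff_fourier (T := 1) n) m
  rw [fourierCoeff] at h
  have hv : (MeasureTheory.volume : MeasureTheory.Measure UnitAddCircle) =
      AddCircle.haarAddCircle := by
    rw [AddCircle.volume_eq_smul_haarAddCircle]
    simp
  rw [hv]
  simp only [smul_eq_mul] at h
  rw [h, Pi.single_apply]
  simp only [eq_comm]

lemma mulTest_apply (g : ℂ → ℂ) (hg : ContDiff ℝ ∞ g) (φ : 𝓓((⊤ : TopologicalSpace.Opens ℂ), ℂ))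
    (z : ℂ) : mulTest g hg φ z = g z * φ z := rfl

/-- Integrated against the `S`-matrix, a character contributes only the delta function whose
Fourier mode in `ν'` matches: integration over `ν'` is orthogonality of the characters of the
circle. -/
lemma integral_Smatrix_mul_character (k : ℂ) (ℓ ℓ' : ℤ) (ν : UnitAddCircle) (ζa τ : ℂ)
    (φ : 𝓓((⊤ : TopologicalSpace.Opens ℂ), ℂ)) :
    (MeasureTheory.Integrable fun ν' : UnitAddCircle =>
      Smatrix k ℓ ν ℓ' ν' * character k ν' ℓ' ζa 1 τ one_ne_zero φ) ∧
    ∫ ν' : UnitAddCircle, Smatrix k ℓ ν ℓ' ν' * character k ν' ℓ' ζa 1 τ one_ne_zero φ =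
      Complex.exp (2 * Real.pi * Complex.I * (((ℓ : ℂ) + ℓ') * k / 3)) * fourier (-ℓ') ν *
        prefactor k ℓ' ζa τ * (1 / 2 * φ ((ℓ - ℓ' * τ) / 2)) := by
  have hα : (2 * 1 : ℂ) ≠ 0 := by norm_num
  set w : ℤ → ℂ := fun n => (‖(2 * 1 : ℂ)‖⁻¹ : ℂ) * φ ((n - ℓ' * τ) / (2 * 1)) with hw
  have hfin : (Function.support w).Finite := by
    have h := finite_support_comb hα (ℓ' * τ) (fun _ => 1) φ
    simpa only [one_mul] using h
  set C : ℂ := Complex.exp (2 * Real.pi * Complex.I * (((ℓ : ℂ) + ℓ') * k / 3)) *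
    fourier (-ℓ') ν * prefactor k ℓ' ζa τ with hC
  have hfun : (fun ν' : UnitAddCircle =>
      Smatrix k ℓ ν ℓ' ν' * character k ν' ℓ' ζa 1 τ one_ne_zero φ) =
      fun ν' => ∑ n ∈ hfin.toFinset, C * w n * (fourier (-ℓ) ν' * fourier n ν') := by
    funext ν'
    rw [character_apply, finsum_eq_sum_of_support_subset (s := hfin.toFinset), Smatrix,
      Finset.mul_sum, Finset.mul_sum]
    · refine Finset.sum_congr rfl fun n _ => ?_
      simp only [hC, hw]
      ring
    · intro n hn
      rw [Set.Finite.coe_toFinset]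
      exact right_ne_zero_of_mul hn
  have hint : ∀ n ∈ hfin.toFinset, MeasureTheory.Integrable fun ν' : UnitAddCircle =>
      C * w n * (fourier (-ℓ) ν' * fourier n ν') := by
    intro n _
    have hc : Continuous fun ν' : UnitAddCircle => C * w n * (fourier (-ℓ) ν' * fourier n ν') := by
      fun_prop
    exact hc.integrable_of_hasCompactSupport (HasCompactSupport.of_compactSpace _)
  rw [hfun]
  refine ⟨MeasureTheory.integrable_finsetSum _ hint, ?_⟩
  rw [MeasureTheory.integral_finsetSum _ hint]
  simp only [MeasureTheory.integral_const_mul, integral_fourier_mul_fourier, mul_ite, mul_one,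
    mul_zero]
  rw [Finset.sum_ite_eq']
  have hwℓ : w ℓ = 1 / 2 * φ ((ℓ - ℓ' * τ) / 2) := by
    simp [hw]
  rw [← hwℓ]
  split_ifs with hmem
  · rfl
  · rw [Set.Finite.mem_toFinset, Function.notMem_support] at hmem
    rw [hmem, mul_zero]

/-- The automorphy factor at the support of the delta functions, `ζd = (ℓ - ℓ' τ) / 2`, relates
the prefactors of the two characters. -/
lemma prefactor_transform (k : ℂ) (ℓ ℓ' : ℤ) (ζa : ℂ) (τ : ℍ) :
    Complex.exp (2 * Real.pi * Complex.I * (((ℓ : ℂ) + ℓ') * k / 3)) * prefactor k ℓ' ζa τ *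
        automorphy k ζa τ ((ℓ - ℓ' * τ) / 2) =
      prefactor k ℓ (ζa / τ) (-1 / τ) * ‖(τ : ℂ)‖ := by
  have hτ : (τ : ℂ) ≠ 0 := τ.ne_zero
  have hη : η τ ≠ 0 := ModularForm.eta_ne_zero τ.2
  have hexp : Complex.exp (2 * Real.pi * Complex.I * (((ℓ : ℂ) + ℓ') * k / 3)) *
      Complex.exp (2 * Real.pi * Complex.I * (ζa * ((ℓ' : ℂ) - 1))) *
      Complex.exp (-(2 * Real.pi * Complex.I * (k * ℓ' * τ / 3))) *
      Complex.exp (4 * Real.pi * Complex.I * (ζa * ((ℓ - ℓ' * τ) / 2) / τ)) *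
      Complex.exp (2 * Real.pi * Complex.I * (ζa * (τ - 1) / τ)) *
      Complex.exp (-(4 * Real.pi * Complex.I * (k * ((ℓ - ℓ' * τ) / 2) * (τ - 1) / (3 * τ)))) =
      Complex.exp (2 * Real.pi * Complex.I * (ζa / τ * ((ℓ : ℂ) - 1))) *
      Complex.exp (-(2 * Real.pi * Complex.I * (k * ℓ * (-1 / τ) / 3))) := by
    simp only [← Complex.exp_add]
    congr 1
    field_simp
    ring
  rw [prefactor, prefactor, automorphy, eta_neg_one_div_sq, ← hexp]
  field_simp

/-- The modular transformation of the characters. -/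
lemma hasSum_integral_Smatrix_mul_character (k : ℂ) (ℓ : ℤ) (ν : UnitAddCircle) (ζa : ℂ) (τ : ℍ)
    (φ : 𝓓((⊤ : TopologicalSpace.Opens ℂ), ℂ)) :
    HasSum (fun ℓ' : ℤ => ∫ ν' : UnitAddCircle, Smatrix k ℓ ν ℓ' ν' *
        character k ν' ℓ' ζa 1 τ one_ne_zero
          (mulTest (automorphy k ζa τ) (contDiff_automorphy k ζa τ) φ))
      (character k ν ℓ (ζa / τ) (1 / τ) (-1 / τ) (one_div_ne_zero τ.ne_zero) φ) := by
  have hτ : (τ : ℂ) ≠ 0 := τ.ne_zero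
  have hα : 2 * (1 / (τ : ℂ)) ≠ 0 := mul_ne_zero two_ne_zero (one_div_ne_zero hτ)
  have hfin := finite_support_comb hα (ℓ * (-1 / τ)) (fun n => fourier n ν) φ
  rw [character_apply, ← tsum_eq_finsum (L := .unconditional ℤ) hfin]
  have h := (summable_of_hasFiniteSupport (L := .unconditional ℤ) hfin).hasSum.mul_left (prefactor k ℓ (ζa / τ) (-1 / τ))
  -- The delta function indexed by `n` on the left matches the summand `ℓ' = -n` on the right.
  rw [← (Equiv.neg ℤ).hasSum_iff] at h
  refine h.congr_fun fun ℓ' => ?_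
  rw [(integral_Smatrix_mul_character k ℓ ℓ' ν ζa τ _).2, mulTest_apply]
  have hpt : (((-ℓ' : ℤ) : ℂ) - ℓ * (-1 / τ)) / (2 * (1 / τ)) = (ℓ - ℓ' * τ) / 2 := by
    push_cast
    field_simp
    ring
  have hnorm : ((‖2 * (1 / (τ : ℂ))‖ : ℝ) : ℂ)⁻¹ = 1 / 2 * ‖(τ : ℂ)‖ := by
    simp [mul_comm]
  simp only [Function.comp_apply, Equiv.neg_apply]
  rw [hpt, hnorm]
  linear_combination (fourier (-ℓ') ν * (1 / 2) * φ ((ℓ - ℓ' * τ) / 2)) *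
    prefactor_transform k ℓ ℓ' ζa τ

end HalfLattice

end

/-- For every level `k`, every `ℓ ∈ ℤ`, `[ν] ∈ ℝ/ℤ`, `ζa ∈ ℂ` and `τ` in the upper half-plane:
the trace character of `Π_ν^ℓ` (also with `ζd` rescaled) is the delta-function expression
`character`, and the latter satisfies
`ch[Π_ν^ℓ](ζa/τ, ζd/τ; -1/τ) = A(ζa, ζd; τ) ∑_{ℓ'} ∫_{ℝ/ℤ} S ch[Π_{ν'}^{ℓ'}](ζa, ζd; τ) d[ν']`
as distributions in `ζd`, that is, after pairing with any test function `φ` of `ζd`. -/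
theorem proposition3p15 (k : ℂ) (ℓ : ℤ) (ν : UnitAddCircle) (ζa : ℂ) (τ : ℍ) :
    (∀ (s : ℂ) (hs : s ≠ 0),
      HalfLattice.IsDistributionalCharacter
        (HalfLattice.moduleMode ν ℓ HalfLattice.Gen.a 0)
        (HalfLattice.moduleMode ν ℓ HalfLattice.Gen.d 0)
        (HalfLattice.moduleT k ν ℓ)
        (HalfLattice.centralCharge k) ζa τ (fun ζd => s * ζd)
        (HalfLattice.character k ν ℓ ζa s τ hs)) ∧
    ∀ φ : 𝓓((⊤ : TopologicalSpace.Opens ℂ), ℂ),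
      (∀ ℓ' : ℤ, MeasureTheory.Integrable fun ν' : UnitAddCircle =>
        HalfLattice.Smatrix k ℓ ν ℓ' ν' *
          HalfLattice.character k ν' ℓ' ζa 1 τ one_ne_zero
            (HalfLattice.mulTest (HalfLattice.automorphy k ζa τ)
              (HalfLattice.contDiff_automorphy k ζa τ) φ)) ∧
      HasSum
        (fun ℓ' : ℤ => ∫ ν' : UnitAddCircle,
          HalfLattice.Smatrix k ℓ ν ℓ' ν' *
            HalfLattice.character k ν' ℓ' ζa 1 τ one_ne_zero
              (HalfLattice.mulTest (HalfLattice.automorphy k ζa τ)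
                (HalfLattice.contDiff_automorphy k ζa τ) φ))
        (HalfLattice.character k ν ℓ (ζa / τ) (1 / τ) (-1 / τ)
          (one_div_ne_zero τ.ne_zero) φ) :=
  ⟨HalfLattice.isDistributionalCharacter k ν ℓ ζa τ, fun φ =>
    ⟨fun ℓ' => (HalfLattice.integral_Smatrix_mul_character k ℓ ℓ' ν ζa τ _).1,
      HalfLattice.hasSum_integral_Smatrix_mul_character k ℓ ν ζa τ φ⟩⟩
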